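/- Let $\boldsymbol\Delta$ be the category of the ordered sets $[k]=\{0<1<\dots<k\}$, $k\ge 0$, and weakly monotone maps, let $n$ be a positive integer, and let $D\colon\boldsymbol\Delta\to\boldsymbol\Delta^n$ be the diagonal embedding, $D([k])=([k],\dots,[k])$, $D(\varphi)=(\varphi,\dots,\varphi)$. A map of simplicial sets is a weak equivalence if its geometric realization is a homotopy equivalence, a simplicial set is contractible if its geometric realization is contractible, and a functor $F\colon C\to C'$ of small categories is homotopy left cofinal if for every object $c$ of $C'$ the nerve of the overcategory $F\downarrow c$ is contractible. The category of simplices of a simplicial set $K$ has the simplices of $K$ as objects and, as morphisms from $\sigma$ to $\tau$, the simplicial operators that take $\tau$ to $\sigma$. Then $D$ is homotopy left cofinal. Moreover, for every object $([p_1],\dots,[p_n])$ of $\boldsymbol\Delta^n$: 1. the functor from $D\downarrow([p_1],\dots,[p_n])$ to the category of simplices of $\Delta[p_1]\times\dots\times\Delta[p_n]$ that sends an object $(\alpha_1,\dots,\alpha_n)\colon([k],\dots,[k])\to([p_1],\dots,[p_n])$ to the $k$-simplex $(\alpha_1,\dots,\alpha_n)$, and a morphism to the simplicial operator given by the same map of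 $\boldsymbol\Delta$, is an isomorphism of categories; 2. there is a weak equivalence from the nerve of $D\downarrow([p_1],\dots,[p_n])$ to $\Delta[p_1]\times\dots\times\Delta[p_n]$; 3. the simplicial set $\Delta[p_1]\times\dots\times\Delta[p_n]$ is contractible. -/

import Mathlib

open CategoryTheory CategoryTheory.Limits

/-- The diagonal embedding `D : Δ ⥤ Δⁿ`, sending `[k]` to `([k], …, [k])` and `φ` to `(φ, …, φ)`.
The category `Δⁿ` is the product category on functions `Fin n → SimplexCategory`. -/
def diagonalEmbedding (n : ℕ) : SimplexCategory ⥤ (Fin n → SimplexCategory) where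
  obj k := fun _ => k
  map φ := fun _ => φ

/-- A map of simplicial sets is a weak equivalence if its geometric realization is a homotopy
equivalence (realizations being CW complexes, this is the same as a weak homotopy equivalence). -/
def SSet.IsWeakEquivalence {X Y : SSet.{0}} (f : X ⟶ Y) : Prop :=
  ∃ e : ContinuousMap.HomotopyEquiv (SSet.toTop.obj X) (SSet.toTop.obj Y),
    e.toFun = (SSet.toTop.map f).hom

/-- A simplicial set is contractible if its geometric realization is contractible. -/
def SSet.IsContractible (X : SSet.{0}) : Prop :=
  ContractibleSpace (SSet.toTop.obj X)

/-- A functor `F : C ⥤ D` of small categories is homotopy left cofinal if for every object `d` of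
`D` the nerve of the overcategory `F ↓ d` is contractible. -/
def IsHomotopyLeftCofinal {C D : Type} [SmallCategory C] [SmallCategory D] (F : C ⥤ D) : Prop :=
  ∀ d : D, SSet.IsContractible (nerve (CostructuredArrow F d))

/-- The category of simplices of a simplicial set `K`: objects are the simplices of `K`, and
morphisms from `σ` to `τ` are the simplicial operators that take `τ` to `σ`. -/
abbrev CategoryOfSimplices (K : SSet.{0}) : Type :=
  (Functor.Elements K)ᵒᵖ

/-- The product `Δ[p₁] × ⋯ × Δ[pₙ]` of standard simplices. -/
noncomputable def prodStdSimplices {n : ℕ} (p : Fin n → SimplexCategory) : SSet.{0} :=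
  ∏ᶜ fun i => SSet.stdSimplex.{0}.obj (p i)

/-- The map `Δ[k] ⟶ Δ[p₁] × ⋯ × Δ[pₙ]` whose components are induced by `αᵢ : [k] ⟶ [pᵢ]`. -/
noncomputable def prodStdSimplices.lift {n : ℕ} {p : Fin n → SimplexCategory}
    {k : SimplexCategory} (α : ∀ i, k ⟶ p i) :
    SSet.stdSimplex.{0}.obj k ⟶ prodStdSimplices p :=
  Pi.lift fun i => SSet.stdSimplex.{0}.map (α i)

theorem prodStdSimplices.map_comp_lift {n : ℕ} {p : Fin n → SimplexCategory}
    {k l : SimplexCategory} (f : k ⟶ l) (α : ∀ i, l ⟶ p i) :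
    SSet.stdSimplex.{0}.map f ≫ prodStdSimplices.lift α =
      prodStdSimplices.lift fun i => f ≫ α i := by
  refine Pi.hom_ext _ _ fun i => ?_
  change (_ ≫ Pi.lift _) ≫ _ = Pi.lift _ ≫ _
  rw [Category.assoc, Pi.lift_π, Pi.lift_π]
  exact (Functor.map_comp _ _ _).symm

/-- The functor from `D ↓ ([p₁], …, [pₙ])` to the category of simplices of `Δ[p₁] × ⋯ × Δ[pₙ]`
which takes `(α₁, …, αₙ) : ([k], …, [k]) ⟶ ([p₁], …, [pₙ])` to the `k`-simplex with
components `αᵢ`, and a morphism to the simplicial operator given by the same map of `Δ`. -/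
noncomputable def overcategoryToSimplices {n : ℕ} (p : Fin n → SimplexCategory) :
    CostructuredArrow (diagonalEmbedding n) p ⥤ CategoryOfSimplices (prodStdSimplices p) where
  obj A := Opposite.op ⟨Opposite.op A.left, SSet.yonedaEquiv (prodStdSimplices.lift A.hom)⟩
  map {A B} f := Quiver.Hom.op ⟨f.left.op, by
    have h : (fun i => f.left ≫ B.hom i) = A.hom := CostructuredArrow.w f
    have e := prodStdSimplices.map_comp_lift f.left B.hom
    rw [h] at e
    exact (SSet.yonedaEquiv_naturality f.left _).trans (congrArg SSet.yonedaEquiv e)⟩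

/-! Both simplicial sets are contracted explicitly. In `D ↓ p`, adjoining a new least vertex, sent
to `0` in every `[pᵢ]`, gives a zigzag `𝟭 ⟶ cone ⟵ const`; the product is contracted by moving all
coordinates to vertex `0` along one common `Δ[1]`. Any map between contractible objects is a weak
equivalence, so the last vertex map serves. The isomorphism of categories is Yoneda: a `k`-simplex
of the product is a tuple of maps `[k] ⟶ [pᵢ]`.

The main work is `homotopic_realization`: simplicial homotopies realize to homotopies. It needs a
continuous map from `|X| × Δ^l` to `|X ⊗ Δ[l]|`. A point of `Δ^k × Δ^l` is the pair of marginals of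
positive weights on a chain mapped monotonically to `[k]` and `[l]` (`hasMonotoneCoupling`), and
positive weights make a monotone map recoverable from its pushforward
(`monotone_eq_of_pushforward_eq`). Existence defines the map; uniqueness makes it well defined. -/

/-! ### Points of the geometric realization -/

/-- The standard topological simplex. -/
abbrev SimplexCategory.TopSimplex (k : SimplexCategory) : Type :=
  stdSimplex ℝ (Fin (k.len + 1))

namespace SSet

open Opposite

/-- The continuous map from the standard topological simplex to the realization of `X` that is
attached to a simplex of `X`. -/
noncomputable def simplexMap {X : SSet.{0}} {k : SimplexCategory} (x : X.obj (op k)) :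
    C(k.TopSimplex, SSet.toTop.obj X) :=
  TopCat.toSSetObjEquiv _ _ ((sSetTopAdj.unit.app X).app (op k) x)

theorem simplexMap_map {X : SSet.{0}} {k l : SimplexCategory} (φ : k ⟶ l) (x : X.obj (op l))
    (t : k.TopSimplex) :
    simplexMap (X.map φ.op x) t = simplexMap x (_root_.stdSimplex.map φ t) := by
  have h := NatTrans.naturality_apply (sSetTopAdj.unit.app X) φ.op x
  exact congrArg (fun q => TopCat.toSSetObjEquiv (SSet.toTop.obj X) (op k) q t) h

theorem toTop_map_simplexMap {X Y : SSet.{0}} (f : X ⟶ Y) {k : SimplexCategory}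
    (x : X.obj (op k)) (t : k.TopSimplex) :
    (SSet.toTop.map f).hom (simplexMap x t) = simplexMap (f.app _ x) t := by
  have h := congrArg (fun q => TopCat.toSSetObjEquiv _ _ (q.app (op k) x) t)
    (sSetTopAdj.unit.naturality f)
  exact h.symm

/-- A compatible family is a simplicial map from `X` to the singular set of `Z`; `G` is its adjoint.
-/
theorem exists_realization_desc {X : SSet.{0}} {Z : Type} [TopologicalSpace Z]
    (g : ∀ {k : SimplexCategory}, X.obj (op k) → C(k.TopSimplex, Z))
    (hg : ∀ {k l : SimplexCategory} (φ : k ⟶ l) (x : X.obj (op l))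
      (t : k.TopSimplex), g (X.map φ.op x) t = g x (_root_.stdSimplex.map φ t)) :
    ∃ G : C(SSet.toTop.obj X, Z), ∀ {k : SimplexCategory} (x : X.obj (op k))
      (t : k.TopSimplex), G (simplexMap x t) = g x t := by
  let a : X ⟶ TopCat.toSSet.obj (TopCat.of Z) :=
    { app := fun k => TypeCat.ofHom fun x =>
        (TopCat.toSSetObjEquiv (TopCat.of Z) k).symm (g (k := k.unop) x)
      naturality := fun k l φ => by
        ext x
        refine (TopCat.toSSetObjEquiv (TopCat.of Z) l).injective ?_
        ext t
        exact hg φ.unop x t }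
  refine ⟨((sSetTopAdj.homEquiv _ _).symm a).hom, fun {k} x t => ?_⟩
  have h : sSetTopAdj.unit.app X ≫ TopCat.toSSet.map ((sSetTopAdj.homEquiv _ _).symm a) = a := by
    exact (Adjunction.homEquiv_unit ..).symm.trans (Equiv.apply_symm_apply _ _)
  exact congrArg (fun q => TopCat.toSSetObjEquiv _ _ (q.app (op k) x) t) h

theorem realization_hom_ext {X : SSet.{0}} {Z : Type} [TopologicalSpace Z]
    {G G' : C(SSet.toTop.obj X, Z)}
    (h : ∀ {k : SimplexCategory} (x : X.obj (op k)) (t : k.TopSimplex),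
      G (simplexMap x t) = G' (simplexMap x t)) : G = G' := by
  have e : (TopCat.ofHom G : SSet.toTop.obj X ⟶ TopCat.of Z) = TopCat.ofHom G' := by
    refine (sSetTopAdj.homEquiv _ _).injective ?_
    ext k x
    refine (TopCat.toSSetObjEquiv (TopCat.of Z) k).injective ?_
    ext t
    rw [Adjunction.homEquiv_unit, Adjunction.homEquiv_unit]
    exact h (k := k.unop) x t
  exact congrArg TopCat.Hom.hom e

theorem exists_simplexMap_eq {X : SSet.{0}} (p : SSet.toTop.obj X) :
    ∃ (k : SimplexCategory) (x : X.obj (op k)) (t : k.TopSimplex),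
      simplexMap x t = p := by
  -- With the indiscrete topology every predicate is continuous, so `realization_hom_ext` can
  -- compare "lies in some simplex" with `True`.
  let : TopologicalSpace Prop := ⊤
  let G : C(SSet.toTop.obj X, Prop) :=
    ⟨fun p => ∃ (k : SimplexCategory) (x : X.obj (op k)) (t : k.TopSimplex),
      simplexMap x t = p, continuous_top⟩
  let G' : C(SSet.toTop.obj X, Prop) := ⟨fun _ => True, continuous_top⟩
  have h : G = G' := realization_hom_ext fun x t => eq_true ⟨_, x, t, rfl⟩
  exact of_eq_true (congrArg (fun q => q.toFun p) h)

end SSet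

/-! ### Monotone couplings -/

theorem sum_filter_fin_cons {m : ℕ} {α : Type*} [DecidableEq α] (r : ℝ) (s : Fin m → ℝ) (x : α)
    (f : Fin m → α) (a : α) :
    ∑ i with (Fin.cons x f : Fin (m + 1) → α) i = a, (Fin.cons r s : Fin (m + 1) → ℝ) i =
      (if x = a then r else 0) + ∑ i with f i = a, s i := by
  simp [Finset.sum_filter, Fin.sum_univ_succ]

theorem sum_filter_succ_eq_zero {m k : ℕ} (s : Fin m → ℝ) (f : Fin m → Fin k) :
    ∑ i with (f i).succ = 0, s i = 0 := by
  simp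

theorem sum_filter_succ_eq_succ {m k : ℕ} (s : Fin m → ℝ) (f : Fin m → Fin k) (a : Fin k) :
    ∑ i with (f i).succ = a.succ, s i = ∑ i with f i = a, s i := by
  simp [Finset.sum_filter]

theorem monotone_fin_cons {m : ℕ} {α : Type*} [Preorder α] {x : α} {f : Fin m → α}
    (hf : Monotone f) (hx : ∀ i, x ≤ f i) : Monotone (Fin.cons x f : Fin (m + 1) → α) := by
  intro i j hij
  induction i using Fin.cases with
  | zero => induction j using Fin.cases with
    | zero => exact le_rfl
    | succ j => simpa using hx j
  | succ i => induction j using Fin.cases with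
    | zero => simp at hij
    | succ j => simpa using hf (by simpa using hij)

/-- Positive weights on a finite chain, together with monotone maps along which the
pushforwards of these weights are the given ones. -/
def HasMonotoneCoupling (N : ℕ) {k l : ℕ} (t : Fin k → ℝ) (u : Fin l → ℝ) : Prop :=
  ∃ m ≤ N, ∃ (r : Fin m → ℝ) (f : Fin m → Fin k) (g : Fin m → Fin l),
    (∀ i, 0 < r i) ∧ Monotone f ∧ Monotone g ∧
    (∀ a, ∑ i with f i = a, r i = t a) ∧ (∀ b, ∑ i with g i = b, r i = u b)

theorem HasMonotoneCoupling.symm {N k l : ℕ} {t : Fin k → ℝ} {u : Fin l → ℝ}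
    (h : HasMonotoneCoupling N t u) : HasMonotoneCoupling N u t := by
  obtain ⟨m, hm, r, f, g, hr, hf, hg, h₁, h₂⟩ := h
  exact ⟨m, hm, r, g, f, hr, hg, hf, h₂, h₁⟩

/-- Northwest-corner rule: an atom at `(0, 0)` carries all of `t 0`, and the rest is a coupling of
what remains. If `t 0 = 0` the atom is omitted, since weights must be positive. -/
theorem HasMonotoneCoupling.cons {N k l : ℕ} {t : Fin (k + 1) → ℝ} {u : Fin (l + 1) → ℝ}
    (h₀ : 0 ≤ t 0)
    (h : HasMonotoneCoupling N (fun i => t i.succ) (u - Pi.single 0 (t 0))) :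
    HasMonotoneCoupling (N + 1) t u := by
  obtain ⟨m, hm, r, f, g, hr, hf, hg, h₁, h₂⟩ := h
  rcases h₀.eq_or_lt with h₀ | h₀
  · refine ⟨m, hm.trans N.le_succ, r, fun i => (f i).succ, g, hr,
      fun i j hij => Fin.succ_le_succ_iff.2 (hf hij), hg, fun a => ?_, fun b => ?_⟩
    · induction a using Fin.cases with
      | zero => rw [sum_filter_succ_eq_zero, h₀]
      | succ a => rw [sum_filter_succ_eq_succ, h₁]
    · simp [h₂, ← h₀]
  · refine ⟨m + 1, Nat.succ_le_succ hm, Fin.cons (t 0) r, Fin.cons 0 fun i => (f i).succ,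
      Fin.cons 0 g, ?_, monotone_fin_cons (fun i j hij => Fin.succ_le_succ_iff.2 (hf hij))
      fun _ => Fin.zero_le _, monotone_fin_cons hg fun _ => Fin.zero_le _,
      fun a => ?_, fun b => ?_⟩
    · exact Fin.cases h₀ hr
    · rw [sum_filter_fin_cons]
      induction a using Fin.cases with
      | zero => rw [sum_filter_succ_eq_zero, if_pos rfl, add_zero]
      | succ a => rw [sum_filter_succ_eq_succ, h₁, if_neg (Fin.succ_ne_zero a).symm, zero_add]
    · rw [sum_filter_fin_cons, h₂]
      simp [Pi.single_apply, eq_comm]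

/-- Two finite families of nonnegative weights with the same total are marginals of a positive
family of weights along monotone maps. -/
theorem hasMonotoneCoupling (N : ℕ) : ∀ (k l : ℕ), k + l ≤ N → ∀ (t : Fin k → ℝ)
    (u : Fin l → ℝ), (∀ i, 0 ≤ t i) → (∀ j, 0 ≤ u j) → ∑ i, t i = ∑ j, u j →
    HasMonotoneCoupling N t u := by
  have empty : ∀ (N l : ℕ) (t : Fin 0 → ℝ) (u : Fin l → ℝ), (∀ j, 0 ≤ u j) →
      ∑ i, t i = ∑ j, u j → HasMonotoneCoupling N t u := by
    intro N l t u hu h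
    refine ⟨0, N.zero_le, Fin.elim0, Fin.elim0, Fin.elim0, fun i => i.elim0, fun i => i.elim0,
      fun i => i.elim0, fun i => i.elim0, fun b => ?_⟩
    have := (Finset.sum_eq_zero_iff_of_nonneg fun j _ => hu j).1
      (h.symm.trans (Finset.sum_of_isEmpty _)) b (Finset.mem_univ b)
    simp [this]
  induction N with
  | zero =>
    intro k l hkl t u ht hu h
    obtain rfl : k = 0 := by omega
    exact empty _ _ _ _ hu h
  | succ N ih =>
    have key : ∀ (k l : ℕ), (k + 1) + (l + 1) ≤ N + 1 → ∀ (t : Fin (k + 1) → ℝ)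
        (u : Fin (l + 1) → ℝ), (∀ i, 0 ≤ t i) → (∀ j, 0 ≤ u j) → ∑ i, t i = ∑ j, u j →
        t 0 ≤ u 0 → HasMonotoneCoupling (N + 1) t u := by
      intro k l hkl t u ht hu h h₀
      refine .cons (ht 0) (ih k (l + 1) (by omega) _ _ (fun i => ht _) (fun j => ?_) ?_)
      · induction j using Fin.cases with
        | zero => simpa using h₀
        | succ j => simpa using hu _
      · rw [Fin.sum_univ_succ] at h
        simp [Finset.sum_sub_distrib, ← h]
    intro k l hkl t u ht hu h
    rcases k with _ | k
    · exact empty _ _ _ _ hu h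
    rcases l with _ | l
    · exact (empty _ _ _ _ ht h.symm).symm
    -- The smaller first weight is used up, so the remainder stays nonnegative and `k + l` drops by
    -- one.
    rcases le_total (t 0) (u 0) with h₀ | h₀
    · exact key k l hkl t u ht hu h h₀
    · exact (key l k (by omega) u t hu ht h.symm h₀).symm

theorem sum_filter_le_eq_of_pushforward_eq {ι α : Type*} [Fintype ι] [LinearOrder α] [Fintype α]
    {r : ι → ℝ} {f g : ι → α}
    (h : ∀ a, ∑ i with f i = a, r i = ∑ i with g i = a, r i) (b : α) :
    ∑ i with f i ≤ b, r i = ∑ i with g i ≤ b, r i := by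
  have key : ∀ f : ι → α, ∑ i with f i ≤ b, r i = ∑ a with a ≤ b, ∑ i with f i = a, r i := by
    intro f
    rw [← Finset.sum_fiberwise_of_maps_to (s := Finset.univ.filter fun i => f i ≤ b)
      (t := Finset.univ.filter (· ≤ b)) (g := f) (by simp)]
    refine Finset.sum_congr rfl fun a ha => Finset.sum_congr ?_ fun _ _ => rfl
    ext i
    simp only [Finset.mem_filter, Finset.mem_univ, true_and] at ha ⊢
    exact ⟨fun h => h.2, fun h => ⟨h ▸ ha, h⟩⟩
  rw [key f, key g]
  exact Finset.sum_congr rfl fun a _ => h a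

/-- If `f i < g i`, then `{g ≤ f i}` is contained in `{f ≤ f i}` and misses `i`, so the cumulative
masses at `f i` differ by at least `r i > 0`. -/
theorem monotone_le_of_pushforward_eq {ι α : Type*} [Fintype ι] [LinearOrder ι] [LinearOrder α]
    [Fintype α] {r : ι → ℝ} (hr : ∀ i, 0 < r i) {f g : ι → α} (hf : Monotone f) (hg : Monotone g)
    (h : ∀ a, ∑ i with f i = a, r i = ∑ i with g i = a, r i) (i : ι) : g i ≤ f i := by
  by_contra! hi
  refine (sum_filter_le_eq_of_pushforward_eq h (f i)).not_gt (Finset.sum_lt_sum_of_subset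
    (i := i) (fun j hj => ?_) (by simp) (by simpa using hi) (hr i) fun j _ _ => (hr j).le)
  simp only [Finset.mem_filter, Finset.mem_univ, true_and] at hj ⊢
  refine hf (le_of_not_gt fun hij => ?_)
  exact (hi.trans_le (hg hij.le)).not_ge hj

theorem monotone_eq_of_pushforward_eq {ι α : Type*} [Fintype ι] [LinearOrder ι] [LinearOrder α]
    [Fintype α] {r : ι → ℝ} (hr : ∀ i, 0 < r i) {f g : ι → α} (hf : Monotone f) (hg : Monotone g)
    (h : ∀ a, ∑ i with f i = a, r i = ∑ i with g i = a, r i) : f = g :=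
  funext fun i => le_antisymm (monotone_le_of_pushforward_eq hr hg hf (fun a => (h a).symm) i)
    (monotone_le_of_pushforward_eq hr hf hg h i)

/-! ### Simplicial homotopies induce homotopies of realizations -/

theorem SimplexCategory.TopSimplex.map_eq_iff {k l : SimplexCategory} (f : k ⟶ l)
    (r : k.TopSimplex) (s : l.TopSimplex) :
    stdSimplex.map f r = s ↔ ∀ a, ∑ i with f i = a, r i = s a := by
  rw [stdSimplex.ext_iff, funext_iff]
  simp only [stdSimplex.map_coe, FunOnFinite.linearMap_apply_apply]

theorem SimplexCategory.TopSimplex.continuous_map {k l : SimplexCategory} (f : k ⟶ l) :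
    Continuous fun t : k.TopSimplex => (stdSimplex.map f t : l.TopSimplex) :=
  stdSimplex.continuous_map f

theorem SimplexCategory.TopSimplex.exists_coupling {k l : SimplexCategory} (s : k.TopSimplex)
    (s' : l.TopSimplex) : ∃ m : Fin (k.len + l.len + 2), ∃ (r : (mk m).TopSimplex)
      (f : mk m ⟶ k) (g : mk m ⟶ l), (∀ i, 0 < r i) ∧
      stdSimplex.map f r = s ∧ stdSimplex.map g r = s' := by
  obtain ⟨m, hm, r, f, g, hr, hf, hg, h₁, h₂⟩ := hasMonotoneCoupling
    (k.len + 1 + (l.len + 1)) _ _ le_rfl s s' s.2.1 s'.2.1 (s.2.2.trans s'.2.2.symm)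
  have hs : ∑ i, r i = 1 := by
    rw [← Finset.sum_fiberwise Finset.univ f r, Finset.sum_congr rfl fun a _ => h₁ a]
    exact s.2.2
  -- Total mass `1` rules out the empty chain; `m + 1` atoms form the chain `[m]`, so the dimension
  -- is strictly below the bound on atoms.
  rcases m with _ | m
  · simp at hs
  · refine ⟨⟨m, by omega⟩, ⟨r, fun i => (hr i).le, hs⟩, Hom.mk ⟨f, hf⟩, Hom.mk ⟨g, hg⟩, hr, ?_, ?_⟩
    · exact (map_eq_iff _ _ _).2 h₁
    · exact (map_eq_iff _ _ _).2 h₂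

theorem SimplexCategory.TopSimplex.hom_ext_of_pos {k l : SimplexCategory} {r : k.TopSimplex}
    (hr : ∀ i, 0 < r i) {f g : k ⟶ l} (h : stdSimplex.map f r = stdSimplex.map g r) : f = g := by
  refine Hom.ext _ _ (OrderHom.ext _ _ ?_)
  refine monotone_eq_of_pushforward_eq hr f.toOrderHom.monotone g.toOrderHom.monotone fun a => ?_
  exact ((map_eq_iff f r _).1 h a).trans ((map_eq_iff g r _).1 rfl a).symm

namespace SSet

open Opposite MonoidalCategory SimplexCategory

/-- The simplex of `X ⊗ Δ[l]` with the given components. -/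
def prodSimplex {X : SSet.{0}} {k l m : SimplexCategory} (x : X.obj (op k)) (α : m ⟶ k)
    (β : m ⟶ l) : (X ⊗ stdSimplex.{0}.obj l).obj (op m) :=
  (X.map α.op x, stdSimplex.objEquiv.symm β)

theorem map_prodSimplex {X : SSet.{0}} {k l m n : SimplexCategory} (x : X.obj (op k)) (α : m ⟶ k)
    (β : m ⟶ l) (γ : n ⟶ m) : (X ⊗ stdSimplex.{0}.obj l).map γ.op (prodSimplex x α β) =
      prodSimplex x (γ ≫ α) (γ ≫ β) := by
  refine Prod.ext ?_ rfl
  exact (X.map_comp_apply α.op γ.op x).symm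

theorem prodSimplex_map {X : SSet.{0}} {j k l m : SimplexCategory} (x : X.obj (op j)) (φ : k ⟶ j)
    (α : m ⟶ k) (β : m ⟶ l) :
    prodSimplex (X.map φ.op x) α β = prodSimplex x (α ≫ φ) β := by
  refine Prod.ext ?_ rfl
  exact (X.map_comp_apply φ.op α.op x).symm

/-- A coupling of `s` and `s'` pulls both sides back to one chain with positive weights, where equal
pushforwards force equal monotone maps. -/
theorem simplexMap_prodSimplex_congr {X : SSet.{0}} {k l m m' : SimplexCategory}
    (x : X.obj (op k)) {α : m ⟶ k} {β : m ⟶ l} {α' : m' ⟶ k} {β' : m' ⟶ l}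
    {s : m.TopSimplex} {s' : m'.TopSimplex}
    (hα : _root_.stdSimplex.map α s = _root_.stdSimplex.map α' s')
    (hβ : _root_.stdSimplex.map β s = _root_.stdSimplex.map β' s') :
    simplexMap (prodSimplex x α β) s = simplexMap (prodSimplex x α' β') s' := by
  obtain ⟨n, r, γ, γ', hr, rfl, rfl⟩ := TopSimplex.exists_coupling s s'
  rw [← simplexMap_map, ← simplexMap_map, map_prodSimplex, map_prodSimplex]
  rw [_root_.stdSimplex.map_comp_apply, _root_.stdSimplex.map_comp_apply] at hα hβ
  have h₁ : γ ≫ α = γ' ≫ α' := TopSimplex.hom_ext_of_pos hr hα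
  have h₂ : γ ≫ β = γ' ≫ β' := TopSimplex.hom_ext_of_pos hr hβ
  rw [h₁, h₂]

theorem exists_prodSimplexMap {X : SSet.{0}} {k l : SimplexCategory} (x : X.obj (op k)) :
    ∃ G : C(k.TopSimplex × l.TopSimplex, SSet.toTop.obj (X ⊗ stdSimplex.{0}.obj l)),
      ∀ {m : SimplexCategory} (α : m ⟶ k) (β : m ⟶ l) (s : m.TopSimplex),
        G (_root_.stdSimplex.map α s, _root_.stdSimplex.map β s) =
          simplexMap (prodSimplex x α β) s := by
  -- Bounding the dimension leaves finitely many summands, so `E` is compact and the surjection `q`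
  -- onto a Hausdorff space is a quotient map.
  let E := Σ c : (Σ m : Fin (k.len + l.len + 2), (mk m ⟶ k) × (mk m ⟶ l)), (mk c.1).TopSimplex
  let q : C(E, k.TopSimplex × l.TopSimplex) :=
    ⟨fun e => (_root_.stdSimplex.map e.1.2.1 e.2, _root_.stdSimplex.map e.1.2.2 e.2),
      continuous_sigma fun c => (TopSimplex.continuous_map c.2.1).prodMk
        (TopSimplex.continuous_map c.2.2)⟩
  let r : C(E, SSet.toTop.obj (X ⊗ stdSimplex.{0}.obj l)) :=
    ⟨fun e => simplexMap (prodSimplex x e.1.2.1 e.1.2.2) e.2,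
      continuous_sigma fun c => (simplexMap (prodSimplex x c.2.1 c.2.2)).continuous⟩
  have hs : Function.Surjective q := by
    rintro ⟨t, u⟩
    obtain ⟨m, s, α, β, -, h₁, h₂⟩ := TopSimplex.exists_coupling t u
    exact ⟨⟨⟨m, α, β⟩, s⟩, Prod.ext h₁ h₂⟩
  have hq : Topology.IsQuotientMap q :=
    q.continuous.isClosedMap.isQuotientMap q.continuous hs
  have hr : Function.FactorsThrough r q := fun e e' h =>
    simplexMap_prodSimplex_congr x (congrArg Prod.fst h) (congrArg Prod.snd h)
  refine ⟨hq.lift r hr, fun {m} α β s => ?_⟩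
  obtain ⟨e, he⟩ := hs (_root_.stdSimplex.map α s, _root_.stdSimplex.map β s)
  rw [← he]
  refine (DFunLike.congr_fun (hq.lift_comp r hr) e).trans ?_
  exact simplexMap_prodSimplex_congr x (congrArg Prod.fst he) (congrArg Prod.snd he)

/-- The continuous map `|X| × |Δ[l]| → |X ⊗ Δ[l]|`, in curried form. -/
theorem exists_realization_prod (X : SSet.{0}) (l : SimplexCategory) :
    ∃ P : C(SSet.toTop.obj X, C(l.TopSimplex, SSet.toTop.obj (X ⊗ stdSimplex.{0}.obj l))),
      ∀ {k m : SimplexCategory} (x : X.obj (op k)) (α : m ⟶ k) (β : m ⟶ l) (s : m.TopSimplex),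
        P (simplexMap x (_root_.stdSimplex.map α s)) (_root_.stdSimplex.map β s) =
          simplexMap (prodSimplex x α β) s := by
  choose G hG using fun (k : SimplexCategory) (x : X.obj (op k)) =>
    exists_prodSimplexMap (l := l) x
  -- Currying reduces the gluing to the universal property of `|X|`, with no need for a product with
  -- `Δ^l` to preserve quotients.
  obtain ⟨P, hP⟩ := exists_realization_desc (X := X) (fun {k} x => (G k x).curry) (by
    intro j k φ x t
    ext u
    obtain ⟨m, s, α, β, -, rfl, rfl⟩ := TopSimplex.exists_coupling t u
    refine (hG _ _ α β s).trans ?_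
    rw [_root_.stdSimplex.map_comp_apply, prodSimplex_map]
    exact (hG _ _ (α ≫ φ) β s).symm)
  refine ⟨P, fun x α β s => ?_⟩
  rw [hP]
  exact hG _ _ α β s

theorem map_const_eq_vertex {k l : SimplexCategory} (v : Fin (l.len + 1)) (t : k.TopSimplex) :
    _root_.stdSimplex.map (SimplexCategory.const k l v) t = _root_.stdSimplex.vertex v := by
  refine (TopSimplex.map_eq_iff _ _ _).2 fun a => ?_
  have h (i : Fin (k.len + 1)) : SimplexCategory.const k l v i = v := rfl
  rcases eq_or_ne v a with rfl | ha
  · simp [h]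
  · simp [h, ha]

theorem homotopic_realization {X Y : SSet.{0}} (H : X ⊗ stdSimplex.{0}.obj (mk 1) ⟶ Y) :
    ContinuousMap.Homotopic (SSet.toTop.map (ι₀ ≫ H)).hom (SSet.toTop.map (ι₁ ≫ H)).hom := by
  obtain ⟨P, hP⟩ := exists_realization_prod X (mk 1)
  -- The pair of `t` and a vertex is the pushforward of `t` itself along the identity and a constant
  -- map.
  have key (v : Fin 2) {k : SimplexCategory} (x : X.obj (op k)) (t : k.TopSimplex) :
      P (simplexMap x t) (_root_.stdSimplex.vertex v) =
        simplexMap (prodSimplex x (𝟙 k) (SimplexCategory.const k (mk 1) v)) t := by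
    rw [← hP, map_const_eq_vertex]
    congr 3
    exact (_root_.stdSimplex.map_id_apply t).symm
  have hc : Continuous fun z : unitInterval × SSet.toTop.obj X =>
      P z.2 (stdSimplexHomeomorphUnitInterval.symm z.1) := by fun_prop
  have h₀ : stdSimplexHomeomorphUnitInterval.symm 0 = _root_.stdSimplex.vertex 0 := by
    rw [Homeomorph.symm_apply_eq]; rfl
  have h₁ : stdSimplexHomeomorphUnitInterval.symm 1 = _root_.stdSimplex.vertex 1 := by
    rw [Homeomorph.symm_apply_eq]; rfl
  refine ⟨⟨⟨fun z => (SSet.toTop.map H).hom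
    (P z.2 (stdSimplexHomeomorphUnitInterval.symm z.1)),
    (SSet.toTop.map H).hom.continuous.comp hc⟩, fun p => ?_, fun p => ?_⟩⟩
  · obtain ⟨k, x, t, rfl⟩ := exists_simplexMap_eq p
    change (SSet.toTop.map H).hom (P _ (stdSimplexHomeomorphUnitInterval.symm 0)) = _
    rw [h₀, key, toTop_map_simplexMap, toTop_map_simplexMap]
    congr 2
    refine congrArg (H.app (op k)) (Prod.ext ?_ rfl)
    exact X.map_id_apply _ x
  · obtain ⟨k, x, t, rfl⟩ := exists_simplexMap_eq p
    change (SSet.toTop.map H).hom (P _ (stdSimplexHomeomorphUnitInterval.symm 1)) = _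
    rw [h₁, key, toTop_map_simplexMap, toTop_map_simplexMap]
    congr 2
    refine congrArg (H.app (op k)) (Prod.ext ?_ rfl)
    exact X.map_id_apply _ x

end SSet

/-! ### Nerves and contractibility -/

namespace SSet

open Opposite MonoidalCategory

section

variable {C D : Type} [SmallCategory C] [SmallCategory D] {F G : C ⥤ D}

/-- The simplicial homotopy between nerves that is induced by a natural transformation. -/
def nerveHomotopy (η : F ⟶ G) :
    nerve C ⊗ stdSimplex.{0}.obj (SimplexCategory.mk 1) ⟶ nerve D where
  app m := TypeCat.ofHom fun z =>
    (Functor.prod' (stdSimplex.objEquiv z.2).toOrderHom.monotone.functor z.1 :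
      Fin (m.unop.len + 1) ⥤ Fin 2 × C) ⋙ Functor.uncurry.obj (ComposableArrows.mk₁ η)
  naturality _ _ _ := rfl

theorem ι₀_nerveHomotopy (η : F ⟶ G) : ι₀ ≫ nerveHomotopy η = nerveMap F := by
  ext m x
  refine CategoryTheory.Functor.ext (fun _ => rfl) fun i j f => ?_
  refine (Category.id_comp _).trans ?_
  exact ((Category.id_comp _).trans (Category.comp_id _)).symm

theorem ι₁_nerveHomotopy (η : F ⟶ G) : ι₁ ≫ nerveHomotopy η = nerveMap G := by
  ext m x
  refine CategoryTheory.Functor.ext (fun _ => rfl) fun i j f => ?_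
  refine (Category.id_comp _).trans ?_
  exact ((Category.id_comp _).trans (Category.comp_id _)).symm

theorem homotopic_nerveMap (η : F ⟶ G) :
    ContinuousMap.Homotopic (SSet.toTop.map (nerveMap F)).hom
      (SSet.toTop.map (nerveMap G)).hom := by
  simpa only [ι₀_nerveHomotopy, ι₁_nerveHomotopy] using homotopic_realization (nerveHomotopy η)

end

theorem toTop_map_const {X Y : SSet.{0}} (y : Y.obj (op (SimplexCategory.mk 0))) :
    ∃ p, (SSet.toTop.map (SSet.const (X := X) y)).hom = ContinuousMap.const _ p := by
  refine ⟨simplexMap y default, ContinuousMap.ext fun q => ?_⟩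
  obtain ⟨k, x, t, rfl⟩ := exists_simplexMap_eq q
  rw [toTop_map_simplexMap]
  refine (simplexMap_map (SimplexCategory.const k _ 0) y t).trans ?_
  exact congrArg (simplexMap y) (Subsingleton.elim _ _)

theorem isContractible_of_homotopic {X : SSet.{0}} (x : X.obj (op (SimplexCategory.mk 0)))
    (h : ContinuousMap.Homotopic (SSet.toTop.map (𝟙 X)).hom (SSet.toTop.map (SSet.const x)).hom) :
    X.IsContractible := by
  obtain ⟨p, hp⟩ := toTop_map_const (X := X) x
  refine (contractible_iff_id_nullhomotopic _).2 ⟨p, ?_⟩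
  rw [hp, CategoryTheory.Functor.map_id] at h
  exact h

/-- The zigzag realizes to two homotopies, from the identity through `T` to a constant map. -/
theorem isContractible_nerve {C : Type} [SmallCategory C] (c : C) (T : C ⥤ C) (η : 𝟭 C ⟶ T)
    (ε : (Functor.const C).obj c ⟶ T) : (nerve C).IsContractible :=
  isContractible_of_homotopic (ComposableArrows.mk₀ c)
    ((homotopic_nerveMap η).trans (homotopic_nerveMap ε).symm)

/-- Self-maps of a contractible space are homotopic to the identity, so any map back is a homotopy
inverse. -/
theorem IsContractible.isWeakEquivalence {X Y : SSet.{0}} (hX : X.IsContractible)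
    (hY : Y.IsContractible) (f : X ⟶ Y) : SSet.IsWeakEquivalence f := by
  have hom (Z : TopCat.{0}) (hZ : ContractibleSpace Z) (g : C(Z, Z)) :
      g.Homotopic (ContinuousMap.id Z) := by
    obtain ⟨p, hp⟩ := id_nullhomotopic Z
    have h : g.Homotopic (ContinuousMap.const Z p) := ContinuousMap.Homotopic.comp hp (.refl g)
    exact h.trans hp.symm
  have : ContractibleSpace (SSet.toTop.obj X) := hX
  have : ContractibleSpace (SSet.toTop.obj Y) := hY
  obtain ⟨e⟩ := ContractibleSpace.hequiv (SSet.toTop.obj Y) (SSet.toTop.obj X)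
  exact ⟨⟨_, e.toFun, hom _ hX _, hom _ hY _⟩, rfl⟩

end SSet

section

open Opposite MonoidalCategory

/-! ### Contractibility of products of standard simplices -/

namespace SSet

/-- The contraction of a standard simplex to its vertex `0`. -/
noncomputable def stdSimplexContraction (k : SimplexCategory) :
    stdSimplex.{0}.obj k ⊗ stdSimplex.{0}.obj (SimplexCategory.mk 1) ⟶ stdSimplex.{0}.obj k :=
  (stdSimplex.isoNerve k.len).hom ▷ _ ≫
    nerveHomotopy (F := (Functor.const _).obj ⊥) (G := 𝟭 (ULift (Fin (k.len + 1))))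
      { app := fun _ => homOfLE bot_le } ≫ (stdSimplex.isoNerve k.len).inv

theorem ι₀_stdSimplexContraction (k : SimplexCategory) :
    ι₀ ≫ stdSimplexContraction k =
      SSet.const (stdSimplex.objEquiv.symm (SimplexCategory.const _ _ 0)) := by
  refine (ι₀_comp_assoc _ _).trans ?_
  rw [← Category.assoc ι₀, ι₀_nerveHomotopy]
  rfl

theorem ι₁_stdSimplexContraction (k : SimplexCategory) :
    ι₁ ≫ stdSimplexContraction k = 𝟙 _ := by
  refine (ι₁_comp_assoc _ _).trans ?_
  rw [← Category.assoc ι₁, ι₁_nerveHomotopy]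
  exact (stdSimplex.isoNerve k.len).hom_inv_id

end SSet

/-- The contractions share one `Δ[1]` and assemble simplicially, so realization need not preserve
products. -/
theorem isContractible_prodStdSimplices {n : ℕ} (p : Fin n → SimplexCategory) :
    (prodStdSimplices p).IsContractible := by
  let π (i : Fin n) : prodStdSimplices p ⟶ SSet.stdSimplex.{0}.obj (p i) :=
    Pi.π (fun i => SSet.stdSimplex.{0}.obj (p i)) i
  let H : prodStdSimplices p ⊗ SSet.stdSimplex.{0}.obj (SimplexCategory.mk 1) ⟶
      prodStdSimplices p := Pi.lift fun i => π i ▷ _ ≫ SSet.stdSimplexContraction (p i)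
  have hH (i : Fin n) : H ≫ π i = π i ▷ _ ≫ SSet.stdSimplexContraction (p i) := Pi.lift_π _ i
  let v : (prodStdSimplices p).obj (op (SimplexCategory.mk 0)) :=
    SSet.yonedaEquiv (prodStdSimplices.lift fun i => SimplexCategory.const _ (p i) 0)
  have hv (i : Fin n) : (π i).app _ v =
      SSet.stdSimplex.objEquiv.symm (SimplexCategory.const _ _ 0) := by
    refine (SSet.yonedaEquiv_comp _ _).symm.trans ?_
    refine (congrArg SSet.yonedaEquiv (Pi.lift_π _ i)).trans ?_
    exact SSet.yonedaEquiv_map _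
  refine SSet.isContractible_of_homotopic v ?_
  have h₀ : SSet.ι₀ ≫ H = SSet.const v := by
    refine Pi.hom_ext _ _ fun i => ?_
    change (SSet.ι₀ ≫ H) ≫ π i = SSet.const v ≫ π i
    rw [Category.assoc, hH, SSet.ι₀_comp_assoc, SSet.ι₀_stdSimplexContraction, SSet.const_comp, hv,
      SSet.comp_const]
  have h₁ : SSet.ι₁ ≫ H = 𝟙 _ := by
    refine Pi.hom_ext _ _ fun i => ?_
    change (SSet.ι₁ ≫ H) ≫ π i = 𝟙 _ ≫ π i
    rw [Category.assoc, hH, SSet.ι₁_comp_assoc, SSet.ι₁_stdSimplexContraction, Category.comp_id,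
      Category.id_comp]
  rw [← h₀, ← h₁]
  exact (SSet.homotopic_realization H).symm

/-! ### Contractibility of the overcategories of the diagonal -/

namespace SimplexCategory

/-- The extension of a map `[k] ⟶ l` to the cone on `[k]` which sends the cone point to `0`. -/
abbrev coneExtend {k l : SimplexCategory} (f : k ⟶ l) : mk (k.len + 1) ⟶ l :=
  SSet.Augmented.StandardSimplex.shift (n := k.len) f

theorem δ_zero_coneExtend {k l : SimplexCategory} (f : k ⟶ l) :
    (δ 0 : k ⟶ mk (k.len + 1)) ≫ coneExtend f = f := by
  ext i
  rfl

theorem cone_hom_ext {k l : SimplexCategory} {f g : mk (k.len + 1) ⟶ l}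
    (h₀ : f 0 = g 0) (h : (δ 0 : k ⟶ mk (k.len + 1)) ≫ f = δ 0 ≫ g) : f = g := by
  refine Hom.ext _ _ (OrderHom.ext _ _ (funext fun i => ?_))
  induction i using Fin.cases with
  | zero => exact h₀
  | succ i => exact congrArg (fun q : k ⟶ l => q i) h

/-- The functor which adds a new least element to a finite ordinal. -/
def cone : SimplexCategory ⥤ SimplexCategory where
  obj k := mk (k.len + 1)
  map {k l} f := coneExtend (f ≫ (δ 0 : l ⟶ mk (l.len + 1)))
  map_id k := by
    refine cone_hom_ext rfl ?_
    rw [δ_zero_coneExtend]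
    rfl
  map_comp f g := by
    refine cone_hom_ext rfl ?_
    rw [δ_zero_coneExtend, ← Category.assoc, δ_zero_coneExtend, Category.assoc, Category.assoc,
      δ_zero_coneExtend]

theorem cone_map_coneExtend {k l m : SimplexCategory} (f : k ⟶ l) (g : l ⟶ m) :
    cone.map f ≫ coneExtend g = coneExtend (f ≫ g) := by
  refine cone_hom_ext rfl ?_
  refine (Category.assoc _ _ _).symm.trans ?_
  refine (congrArg (· ≫ coneExtend g) (δ_zero_coneExtend _)).trans ?_
  rw [Category.assoc, δ_zero_coneExtend, δ_zero_coneExtend]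

end SimplexCategory

open SimplexCategory in
/-- The endofunctor of `D ↓ p` which adds the least vertex to a tuple of maps. -/
def overcategoryCone {n : ℕ} (p : Fin n → SimplexCategory) :
    CostructuredArrow (diagonalEmbedding n) p ⥤ CostructuredArrow (diagonalEmbedding n) p where
  obj A := CostructuredArrow.mk (Y := cone.obj A.left) fun i => coneExtend (A.hom i)
  map {A B} f := CostructuredArrow.homMk (cone.map f.left) <| funext fun i =>
    (cone_map_coneExtend _ _).trans (congrArg (fun q => coneExtend (q i)) (CostructuredArrow.w f))
  map_id A := by
    ext : 1
    exact cone.map_id _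
  map_comp f g := by
    ext : 1
    exact cone.map_comp _ _

open SimplexCategory in
-- Both the inclusion `δ 0` into the cone and the inclusion of the cone point are natural over `p`,
-- the latter because `cone.map` fixes the new vertex.
theorem isContractible_nerve_overcategory {n : ℕ} (p : Fin n → SimplexCategory) :
    (nerve (CostructuredArrow (diagonalEmbedding n) p)).IsContractible := by
  refine SSet.isContractible_nerve
    (CostructuredArrow.mk (Y := mk 0) fun i => SimplexCategory.const (mk 0) (p i) 0)
    (overcategoryCone p)
    { app := fun A => CostructuredArrow.homMk (δ 0 : A.left ⟶ mk (A.left.len + 1))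
        (funext fun i => δ_zero_coneExtend _)
      naturality := fun A B f => ?_ }
    { app := fun A => CostructuredArrow.homMk (SimplexCategory.const (mk 0) (mk (A.left.len + 1)) 0)
        (funext fun i => ?_)
      naturality := fun A B f => ?_ }
  · ext : 1
    exact (δ_zero_coneExtend _).symm
  · ext j
    rfl
  · ext : 1
    rfl

/-! ### The overcategory is the category of simplices -/

/-- Bijectivity on objects makes the inverse strict; `eqToHom` transports morphisms before taking
preimages. -/
theorem CategoryTheory.Functor.exists_strict_inverse {C D : Type*} [Category C] [Category D]
    (F : C ⥤ D) [F.Full] [F.Faithful] (h : Function.Bijective F.obj) :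
    ∃ G : D ⥤ C, F ⋙ G = 𝟭 C ∧ G ⋙ F = 𝟭 D := by
  let e := Equiv.ofBijective F.obj h
  have he (X : D) : F.obj (e.symm X) = X := e.apply_symm_apply X
  have he' (X : C) : e.symm (F.obj X) = X := e.symm_apply_apply X
  let G : D ⥤ C :=
    { obj := e.symm
      map := fun {X Y} f => F.preimage (eqToHom (he X) ≫ f ≫ eqToHom (he Y).symm)
      map_id := fun X => F.map_injective (by simp)
      map_comp := fun f g => F.map_injective (by simp) }
  refine ⟨G, CategoryTheory.Functor.ext he' fun X Y f => F.map_injective ?_,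
    CategoryTheory.Functor.ext he fun X Y f => ?_⟩
  · simp [G, eqToHom_map]
  · simp [G]

theorem prodStdSimplices.lift_injective {n : ℕ} {p : Fin n → SimplexCategory}
    {k : SimplexCategory} {α β : ∀ i, k ⟶ p i}
    (h : prodStdSimplices.lift α = prodStdSimplices.lift β) : α = β := by
  funext i
  refine SSet.stdSimplex.{0}.map_injective ?_
  have := congrArg (· ≫ Pi.π (fun i => SSet.stdSimplex.{0}.obj (p i)) i) h
  exact (Pi.lift_π _ i).symm.trans (this.trans (Pi.lift_π _ i))

theorem prodStdSimplices.lift_surjective {n : ℕ} {p : Fin n → SimplexCategory}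
    {k : SimplexCategory} (f : SSet.stdSimplex.{0}.obj k ⟶ prodStdSimplices p) :
    ∃ α : ∀ i, k ⟶ p i, prodStdSimplices.lift α = f := by
  refine ⟨fun i => SSet.stdSimplex.{0}.preimage
    (f ≫ Pi.π (fun i => SSet.stdSimplex.{0}.obj (p i)) i), Pi.hom_ext _ _ fun i => ?_⟩
  exact (Pi.lift_π _ i).trans (SSet.stdSimplex.{0}.map_preimage _)

section

variable {n : ℕ} (p : Fin n → SimplexCategory)

instance : (overcategoryToSimplices p).Faithful where
  map_injective {A B f g} h := by
    ext : 1
    exact congrArg (fun q => q.unop.1.unop) h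

instance : (overcategoryToSimplices p).Full where
  map_surjective {A B} g := by
    refine ⟨CostructuredArrow.homMk g.unop.1.unop ?_, rfl⟩
    refine prodStdSimplices.lift_injective (SSet.yonedaEquiv.injective ?_)
    refine (congrArg SSet.yonedaEquiv
      (prodStdSimplices.map_comp_lift g.unop.1.unop B.hom)).symm.trans ?_
    exact (SSet.yonedaEquiv_naturality g.unop.1.unop _).symm.trans g.unop.2

theorem overcategoryToSimplices_obj_bijective :
    Function.Bijective (overcategoryToSimplices p).obj := by
  refine ⟨fun A B h => ?_, fun X => ?_⟩
  · obtain ⟨k, α, rfl⟩ := A.mk_surjective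
    obtain ⟨l, β, rfl⟩ := B.mk_surjective
    have h' := Sigma.mk.inj (congrArg unop h)
    obtain rfl : k = l := congrArg unop h'.1
    have := prodStdSimplices.lift_injective (SSet.yonedaEquiv.injective (eq_of_heq h'.2))
    exact congrArg CostructuredArrow.mk this
  · obtain ⟨⟨⟨k⟩, x⟩⟩ := X
    obtain ⟨α, hα⟩ := prodStdSimplices.lift_surjective (SSet.yonedaEquiv.symm x)
    refine ⟨CostructuredArrow.mk (Y := k) α, ?_⟩
    refine congrArg (fun y => op (⟨op k, y⟩ : (prodStdSimplices p).Elements)) ?_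
    exact (congrArg SSet.yonedaEquiv hα).trans (Equiv.apply_symm_apply _ _)

/-- The functor `D ↓ p ⥤ [pᵢ]` given by the last vertex of the `i`-th component. -/
def lastVertexFunctor (i : Fin n) :
    CostructuredArrow (diagonalEmbedding n) p ⥤ ULift.{0} (Fin ((p i).len + 1)) where
  obj A := ULift.up (A.hom i (Fin.last A.left.len))
  map {A B} f := homOfLE <| by
    have h : f.left ≫ B.hom i = A.hom i := congrFun (CostructuredArrow.w f) i
    change A.hom i (Fin.last _) ≤ B.hom i (Fin.last _)
    rw [← h]
    exact (B.hom i).toOrderHom.monotone (Fin.le_last _)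

/-- The last vertex map from the nerve of `D ↓ p` to the product of standard simplices. -/
noncomputable def lastVertexMap :
    nerve (CostructuredArrow (diagonalEmbedding n) p) ⟶ prodStdSimplices p :=
  Pi.lift fun i => nerveMap (lastVertexFunctor p i) ≫ (SSet.stdSimplex.isoNerve (p i).len).inv

end

end

theorem mainTheorem10 (n : ℕ) (hn : 0 < n) :
    IsHomotopyLeftCofinal (diagonalEmbedding n) ∧
    ∀ p : Fin n → SimplexCategory,
      (∃ G : CategoryOfSimplices (prodStdSimplices p) ⥤ CostructuredArrow (diagonalEmbedding n) p,
        overcategoryToSimplices p ⋙ G = 𝟭 _ ∧ G ⋙ overcategoryToSimplices p = 𝟭 _) ∧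
      (∃ f : nerve (CostructuredArrow (diagonalEmbedding n) p) ⟶ prodStdSimplices p,
        SSet.IsWeakEquivalence f) ∧
      SSet.IsContractible (prodStdSimplices p) :=
  ⟨isContractible_nerve_overcategory, fun p =>
    ⟨(overcategoryToSimplices p).exists_strict_inverse (overcategoryToSimplices_obj_bijective p),
      ⟨lastVertexMap p, (isContractible_nerve_overcategory p).isWeakEquivalence
        (isContractible_prodStdSimplices p) _⟩, isContractible_prodStdSimplices p⟩⟩
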